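/- All graphs are finite, simple and undirected, without input labels. A graph problem $\Pi$ consists of a (possibly infinite) set $\Gamma$ of output labels and, for every graph $G=(V,E)$, a set $\Pi(G)\subseteq\Gamma^V$ of solutions. Throughout, problems are isomorphism-invariant (for every isomorphism $\alpha$ from $G$ to $H$, $\Pi(G)=\{\sigma\circ\alpha:\sigma\in\Pi(H)\}$) and component-wise ($\sigma\in\Pi(G)$ if and only if the restriction of $\sigma$ to the node set of every connected component $H$ of $G$ lies in $\Pi(H)$). In the multiset-broadcast model $\mathsf{MB}$, all nodes of the input graph are anonymous and run the same deterministic state machine in synchronous rounds. In every round, each node that has not yet halted broadcasts one message of unrestricted size, determined by its current state, to all its neighbors, receives the multiset of the messages broadcast by its neighbors, and enters a new state determined by its current state and this multiset. A node that reaches a stopping state halts with an output. In the non-uniform setting, the initial state of a node is determined by its degree and by the number $n$ of nodes of the graph. Let $\mathtt{failed}\notin\Gamma$ be a special label. An algorithm $\mathcal A$ with outputs in $\Gamma\cup\{\mathtt{failed}\}$, whose output labeling on $G$ is denoted by $\mathcal A(G)$, is sound for $\Pi$ if 1. $\mathbb P(\mathcal A(G)\in\Pi(G))\to1$ as $n\to\infty$,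 where $G\sim G(n,1/2)$ is a uniformly random graph on $\{1,\dots,n\}$, and 2. for every graph $G$, if $\mathcal A(G)\notin\Pi(G)$, then all nodes output $\mathtt{failed}$ on $G$. For $r\in\mathbb N$, let $\mathsf{MB}_{n\text{-}\mathrm{snd}}[r]$ be the class of all problems $\Pi$ that admit a sound non-uniform $\mathsf{MB}$ algorithm in which, on every input graph, all nodes have halted after at most $r$ rounds. **Corollary.** $\mathsf{MB}_{n\text{-}\mathrm{snd}}[3]\subsetneq\mathsf{MB}_{n\text{-}\mathrm{snd}}[4]$; that is, every problem in $\mathsf{MB}_{n\text{-}\mathrm{snd}}[3]$ is in $\mathsf{MB}_{n\text{-}\mathrm{snd}}[4]$, and some problem in $\mathsf{MB}_{n\text{-}\mathrm{snd}}[4]$ is not in $\mathsf{MB}_{n\text{-}\mathrm{snd}}[3]$. -/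

import Mathlib

open Filter Topology

/-- A distributed graph problem: a set of output labels and, for every finite simple graph
(without input labels), a set of labelings of its nodes that count as solutions. As throughout the
theory, problems are isomorphism-invariant and component-wise. -/
structure GraphProblem where
  /-- The (possibly infinite) set of output labels. -/
  Label : Type
  /-- The set of solutions on a graph. -/
  sol : ∀ {V : Type} [Finite V], SimpleGraph V → Set (V → Label)
  /-- The solutions on `G` are exactly the pullbacks of the solutions on an isomorphic copy. -/
  iso_invariant : ∀ {V W : Type} [Finite V] [Finite W] (G : SimpleGraph V) (H : SimpleGraph W)
    (α : G ≃g H), sol G = {τ | ∃ σ ∈ sol H, τ = fun v => σ (α v)}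
  /-- A labeling is a solution iff its restriction to every connected component is one. -/
  component_wise : ∀ {V : Type} [Finite V] (G : SimpleGraph V) (σ : V → Label),
    σ ∈ sol G ↔ ∀ C : G.ConnectedComponent, (fun v : C => σ v) ∈ sol C.toSimpleGraph

/-- The finite set of neighbors of a node of a finite graph. -/
noncomputable def nbrs {V : Type} [Finite V] (G : SimpleGraph V) (v : V) : Finset V :=
  (Set.toFinite (G.neighborSet v)).toFinset

/-- A deterministic anonymous algorithm in the multiset-broadcast model, in the non-uniform
setting: a state machine, the same for all nodes and all graphs, whose initial state depends on the
number of nodes and on the degree of the node. -/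
structure MBAlgorithm (Out : Type) where
  /-- States. -/
  State : Type
  /-- Messages (of unrestricted size). -/
  Msg : Type
  /-- The initial state, given the number of nodes of the graph and the degree of the node. -/
  init : (numNodes degree : ℕ) → State
  /-- The message that a node which has not halted broadcasts to all its neighbors. -/
  send : State → Msg
  /-- The new state, given the current state and the multiset of messages of the neighbors;
  `none` is the absence of a message from a neighbor that has halted. -/
  update : State → Multiset (Option Msg) → State
  /-- `some o` on the stopping states with output `o`, and `none` on all other states. -/
  output : State → Option Out

namespace MBAlgorithm

variable {Out : Type} (A : MBAlgorithm Out)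

/-- What is broadcast in a given state: halted nodes are silent. -/
def broadcast (s : A.State) : Option A.Msg :=
  match A.output s with
  | some _ => none
  | none => some (A.send s)

/-- One step of a node: halted nodes stay in their state, all others are updated. -/
def step (s : A.State) (received : Multiset (Option A.Msg)) : A.State :=
  match A.output s with
  | some _ => s
  | none => A.update s received

/-- The state of each node after `t` synchronous rounds of the algorithm on the graph `G`. -/
noncomputable def stateAt {V : Type} [Finite V] (G : SimpleGraph V) : ℕ → V → A.State
  | 0 => fun v => A.init (Nat.card V) (nbrs G v).card
  | t + 1 => fun v =>
      A.step (stateAt G t v) ((nbrs G v).val.map fun w => A.broadcast (stateAt G t w))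

/-- On the input graph `G` every node eventually halts, and `τ` is the labeling of the nodes by
their outputs. -/
def HaltsWith {V : Type} [Finite V] (G : SimpleGraph V) (τ : V → Out) : Prop :=
  ∃ t, ∀ v, A.output (A.stateAt G t v) = some (τ v)

/-- The time complexity is at most `r`: on every input graph, all nodes have reached a stopping
state after `r` rounds. -/
def RunsInRounds (r : ℕ) : Prop :=
  ∀ {V : Type} [Finite V] (G : SimpleGraph V) (v : V), (A.output (A.stateAt G r v)).isSome

end MBAlgorithm

/-- The output alphabet of a (possibly failing) algorithm for a problem with label set `Γ`:
`some γ` is the label `γ`, and `none` is the special label `failed`, which is not in `Γ`. -/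
abbrev WithFailed (Γ : Type) : Type := Option Γ

/-- On the input graph `G` the algorithm outputs a solution of the problem `P`. -/
def MBAlgorithm.SolvesOn (P : GraphProblem) (A : MBAlgorithm (WithFailed P.Label))
    {V : Type} [Finite V] (G : SimpleGraph V) : Prop :=
  ∃ σ ∈ P.sol G, A.HaltsWith G (fun v => some (σ v))

/-- The edge probability `1/2`. -/
noncomputable def edgeProbHalf : unitInterval := ⟨1 / 2, by norm_num, by norm_num⟩

/-- The algorithm solves `P` asymptotically almost surely on the random graph `G(n, 1/2)`. -/
def MBAlgorithm.SolvesAAS (P : GraphProblem) (A : MBAlgorithm (WithFailed P.Label)) : Prop :=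
  Tendsto (fun n : ℕ => SimpleGraph.binomialRandom (Fin n) edgeProbHalf
    {G : SimpleGraph (Fin n) | A.SolvesOn P G}) atTop (𝓝 1)

/-- The algorithm is sound for `P`: it solves `P` asymptotically almost surely, and on every graph
on which it does not output a solution, all nodes output `failed`. -/
def MBAlgorithm.Sound (P : GraphProblem) (A : MBAlgorithm (WithFailed P.Label)) : Prop :=
  A.SolvesAAS P ∧
    ∀ {V : Type} [Finite V] (G : SimpleGraph V),
      ¬ A.SolvesOn P G → A.HaltsWith G (fun _ => none)

/-- The class of problems solvable by non-uniform sound multiset-broadcast algorithms in (at most)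
`r` rounds. -/
def MBnsnd (r : ℕ) : Set GraphProblem :=
  {P | ∃ A : MBAlgorithm (WithFailed P.Label), A.RunsInRounds r ∧ A.Sound P}

/-! The separating problem is `refineProblem 4`: output the color of round 4 of color refinement.
Four rounds compute it on every graph. After three rounds a state depends only on the number of
nodes and the color of round 3 (`stateAt_eq_stateOfColor`). If graphs `G` and `H` on the same nodes
give `v` equal colors in round 3 but different ones in round 4, a sound 3-round algorithm cannot
solve `G`: `v` would output the same label on `H`, so it does not fail there and must be correct on
`H` too (`not_solvesOn_of_refineColor_eq`).

It remains to find such an `H` for a typical `G`. Replace edges `ab`, `cd` by `ad`, `cb`, where the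
four nodes have equal degrees, none is `v` or a neighbor of `v`, and `a` is at distance 2 from `v`.
Rounds 0 and 1 do not notice; in round 2 at most the four endpoints change, which is too far away
for `v` in round 3. If the colors of round 1 are pairwise distinct, they identify the neighbors of
`a`, so round 4 at `v` sees the change (`exists_refineColor_three_eq_four_ne`).

Counting shows that random graphs typically have distinct colors in round 1, concentrated degrees
and no large homogeneous bipartite pairs (`exists_typical`). These properties provide the switch
(`NoHomogeneousPair.exists_refineColor`). -/

/-! ### Color refinement as a graph problem. -/

/-- The colors of color refinement: the color of round `0` is the degree, and the color of round
`t + 1` encodes the color of round `t` and the multiset of the colors of round `t` of the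
neighbors. -/
noncomputable def refineColor {V : Type} [Finite V] (G : SimpleGraph V) : ℕ → V → ℕ
  | 0 => fun v => (nbrs G v).card
  | t + 1 => fun v =>
      Encodable.encode (refineColor G t v, (nbrs G v).val.map (refineColor G t))

theorem mem_nbrs {V : Type} [Finite V] {G : SimpleGraph V} {v w : V} :
    w ∈ nbrs G v ↔ G.Adj v w := by
  simp [nbrs]

theorem refineColor_succ_eq_iff {V W : Type} [Finite V] [Finite W] {G : SimpleGraph V}
    {H : SimpleGraph W} {t : ℕ} {v : V} {w : W} :
    refineColor G (t + 1) v = refineColor H (t + 1) w ↔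
      refineColor G t v = refineColor H t w ∧
        (nbrs G v).val.map (refineColor G t) = (nbrs H w).val.map (refineColor H t) := by
  simp only [refineColor]
  rw [Encodable.encode_inj, Prod.mk.injEq]

/-- Color refinement is invariant under local isomorphisms. -/
theorem refineColor_comp {V W : Type} [Finite V] [Finite W] {G : SimpleGraph V}
    {H : SimpleGraph W} (φ : V ↪ W) (h : ∀ v, (nbrs G v).map φ = nbrs H (φ v)) (t : ℕ) (v : V) :
    refineColor G t v = refineColor H t (φ v) := by
  induction t generalizing v with
  | zero => simp [refineColor, ← h]
  | succ t ih =>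
    rw [refineColor_succ_eq_iff]
    refine ⟨ih v, ?_⟩
    rw [← h, Finset.map_val, Multiset.map_map]
    exact Multiset.map_congr rfl fun w _ => ih w

theorem refineColor_iso {V W : Type} [Finite V] [Finite W] {G : SimpleGraph V}
    {H : SimpleGraph W} (α : G ≃g H) (t : ℕ) (v : V) :
    refineColor G t v = refineColor H t (α v) := by
  refine refineColor_comp α.toEquiv.toEmbedding (fun v => ?_) t v
  ext w
  simp only [Finset.mem_map, mem_nbrs, Equiv.coe_toEmbedding]
  constructor
  · rintro ⟨u, hu, rfl⟩
    exact α.map_adj_iff.2 hu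
  · intro hw
    exact ⟨α.symm w, α.map_adj_iff.1 (by simpa using hw), by simp⟩

theorem refineColor_component {V : Type} [Finite V] {G : SimpleGraph V}
    (C : G.ConnectedComponent) (t : ℕ) (v : C) :
    refineColor C.toSimpleGraph t v = refineColor G t v := by
  refine refineColor_comp (Function.Embedding.subtype _) (fun v => ?_) t v
  ext w
  simp only [Finset.mem_map, mem_nbrs, Function.Embedding.subtype_apply]
  constructor
  · rintro ⟨u, hu, rfl⟩
    exact hu
  · intro hw
    have hwC : w ∈ C := by
      have hv : G.connectedComponentMk v.1 = C := v.2
      show G.connectedComponentMk w = C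
      rw [← hv]
      exact (SimpleGraph.ConnectedComponent.connectedComponentMk_eq_of_adj hw).symm
    exact ⟨⟨w, hwC⟩, hw, rfl⟩

/-- The problem of computing the color of a given round of color refinement. -/
noncomputable def refineProblem (t : ℕ) : GraphProblem where
  Label := ℕ
  sol G := {refineColor G t}
  iso_invariant G H α := by
    ext τ
    simp only [Set.mem_singleton_iff, exists_eq_left, Set.mem_ofPred_eq]
    rw [show refineColor G t = fun v => refineColor H t (α v) from
      funext fun v => refineColor_iso α t v]
  component_wise G σ := by
    simp only [Set.mem_singleton_iff]
    constructor
    · rintro rfl C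
      funext v
      exact (refineColor_component C t v).symm
    · intro h
      funext v
      have := congrFun (h (G.connectedComponentMk v)) ⟨v, rfl⟩
      rw [this, refineColor_component]

/-- The algorithm that computes the color of round `r` of color refinement. -/
noncomputable def refineAlgorithm (r : ℕ) : MBAlgorithm (WithFailed ℕ) where
  State := ℕ × ℕ
  Msg := ℕ
  init _ d := (0, d)
  send s := s.2
  -- The default `0` is never used in an actual run: all nodes halt simultaneously, in round `r`.
  update s M := (s.1 + 1, Encodable.encode (s.2, M.map fun m => m.getD 0))
  output s := if s.1 = r then some (some s.2) else none

theorem refineAlgorithm_stateAt (r : ℕ) {V : Type} [Finite V] (G : SimpleGraph V) (t : ℕ)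
    (ht : t ≤ r) (v : V) :
    (refineAlgorithm r).stateAt G t v = ((t, refineColor G t v) : ℕ × ℕ) := by
  induction t generalizing v with
  | zero => rfl
  | succ t ih =>
    have hne : t ≠ r := by omega
    have ih' := fun w => ih (by omega) w
    have hb : ∀ w, (refineAlgorithm r).broadcast ((refineAlgorithm r).stateAt G t w)
        = some (refineColor G t w) := by
      intro w
      rw [ih']
      simp [MBAlgorithm.broadcast, refineAlgorithm, hne]
    simp only [MBAlgorithm.stateAt, hb]
    rw [ih']
    simp [MBAlgorithm.step, refineAlgorithm, hne, refineColor]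

theorem refineAlgorithm_output (r : ℕ) {V : Type} [Finite V] (G : SimpleGraph V) (v : V) :
    (refineAlgorithm r).output ((refineAlgorithm r).stateAt G r v) =
      some (some (refineColor G r v)) := by
  rw [refineAlgorithm_stateAt r G r le_rfl]
  simp [refineAlgorithm]

theorem refineProblem_mem_MBnsnd (r : ℕ) : refineProblem r ∈ MBnsnd r := by
  have hs : ∀ {V : Type} [Finite V] (G : SimpleGraph V),
      MBAlgorithm.SolvesOn (refineProblem r) (refineAlgorithm r) G := by
    intro V _ G
    exact ⟨refineColor G r, rfl, r, refineAlgorithm_output r G⟩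
  refine ⟨refineAlgorithm r, ?_, ?_, ?_⟩
  · intro V _ G v
    exact congrArg Option.isSome (refineAlgorithm_output r G v)
  · have : ∀ n : ℕ, {G : SimpleGraph (Fin n) |
        MBAlgorithm.SolvesOn (refineProblem r) (refineAlgorithm r) G} = Set.univ :=
      fun n => Set.eq_univ_of_forall fun G => hs G
    simp only [MBAlgorithm.SolvesAAS, this, MeasureTheory.measure_univ]
    exact tendsto_const_nhds
  · intro V _ G h
    exact absurd (hs G) h

/-! ### Algorithms factor through color refinement. -/

namespace MBAlgorithm

theorem output_stateAt_of_le {Out : Type} (A : MBAlgorithm Out) {V : Type} [Finite V]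
    {G : SimpleGraph V} {v : V} {s t : ℕ} (hst : s ≤ t) {o : Out}
    (h : A.output (A.stateAt G s v) = some o) : A.output (A.stateAt G t v) = some o := by
  induction t, hst using Nat.le_induction with
  | base => exact h
  | succ t _ ih => simp [stateAt, step, ih]

theorem output_eq_of_haltsWith {Out : Type} (A : MBAlgorithm Out) {r : ℕ} (hr : A.RunsInRounds r)
    {V : Type} [Finite V] {G : SimpleGraph V} {τ : V → Out} (h : A.HaltsWith G τ) (v : V) :
    A.output (A.stateAt G r v) = some (τ v) := by
  obtain ⟨t, ht⟩ := h
  obtain ⟨o, ho⟩ := Option.isSome_iff_exists.1 (hr G v)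
  have h1 := A.output_stateAt_of_le (le_max_left r t) ho
  have h2 := A.output_stateAt_of_le (le_max_right r t) (ht v)
  rw [ho, ← h1, h2]

/-- The state after `t` rounds as a function of the color of round `t`. -/
noncomputable def stateOfColor {Out : Type} (A : MBAlgorithm Out) (n : ℕ) : ℕ → ℕ → A.State
  | 0 => fun c => A.init n c
  | t + 1 => fun c =>
      let p := ((Encodable.decode c : Option (ℕ × Multiset ℕ))).getD (0, 0)
      A.step (stateOfColor A n t p.1) (p.2.map fun d => A.broadcast (stateOfColor A n t d))

/-- The color of round `t` can be decoded into everything a node may have learned in `t` rounds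
besides the number of nodes, so no algorithm distinguishes more than color refinement does. -/
theorem stateAt_eq_stateOfColor {Out : Type} (A : MBAlgorithm Out) {V : Type} [Finite V]
    (G : SimpleGraph V) (t : ℕ) (v : V) :
    A.stateAt G t v = A.stateOfColor (Nat.card V) t (refineColor G t v) := by
  induction t generalizing v with
  | zero => rfl
  | succ t ih => simp [stateAt, stateOfColor, refineColor, ih]

end MBAlgorithm

theorem MBnsnd_mono {r s : ℕ} (h : r ≤ s) : MBnsnd r ⊆ MBnsnd s := by
  rintro P ⟨A, hA, hs⟩
  refine ⟨A, fun G v => ?_, hs⟩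
  obtain ⟨o, ho⟩ := Option.isSome_iff_exists.1 (hA G v)
  rw [A.output_stateAt_of_le h ho]
  rfl

/-- A sound algorithm with `r` rounds for color refinement cannot be correct on a graph with a node
whose color of round `r` occurs with another color of the target round in a graph with the same
number of nodes. -/
theorem not_solvesOn_of_refineColor_eq {r s : ℕ} {A : MBAlgorithm (WithFailed ℕ)}
    (hr : A.RunsInRounds r) (hs : MBAlgorithm.Sound (refineProblem s) A)
    {V : Type} [Finite V] {G H : SimpleGraph V} {v : V}
    (heq : refineColor G r v = refineColor H r v)
    (hne : refineColor G s v ≠ refineColor H s v) :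
    ¬ MBAlgorithm.SolvesOn (refineProblem s) A G := by
  rintro ⟨σ, rfl, hG⟩
  have h1 := A.output_eq_of_haltsWith hr hG v
  rw [A.stateAt_eq_stateOfColor, heq, ← A.stateAt_eq_stateOfColor H] at h1
  -- Either way `v` repeats on `H` its output on `G`: a correct answer on `H` contradicts `hne`, and
  -- `failed` is not a label.
  by_cases hH : MBAlgorithm.SolvesOn (refineProblem s) A H
  · obtain ⟨σ', rfl, hH⟩ := hH
    have h2 := A.output_eq_of_haltsWith hr hH v
    rw [h2] at h1
    exact hne (Option.some.inj (Option.some.inj h1)).symm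
  · have h2 := A.output_eq_of_haltsWith hr (hs.2 H hH) v
    rw [h2] at h1
    exact absurd (Option.some.inj h1).symm (Option.some_ne_none _)

/-! ### Resampling the neighborhood of one node. -/

open scoped Classical in
/-- The graph `G` with the neighborhood of `a` replaced by `A`. -/
noncomputable def replaceNbrs {V : Type} (G : SimpleGraph V) (a : V) (A : Finset V) :
    SimpleGraph V where
  Adj x y := x ≠ y ∧ if x = a then y ∈ A else if y = a then x ∈ A else G.Adj x y
  symm := ⟨by
    intro x y ⟨hne, h⟩
    refine ⟨hne.symm, ?_⟩
    by_cases hx : x = a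
    · have hy : y ≠ a := fun hy => hne (hx.trans hy.symm)
      simpa [hx, hy] using h
    · by_cases hy : y = a
      · simpa [hx, hy] using h
      · simpa [hx, hy, G.adj_comm] using h⟩
  loopless := ⟨fun x h => h.1 rfl⟩

section replaceNbrs

variable {V : Type} {G : SimpleGraph V} {a x y : V} {A : Finset V}

theorem replaceNbrs_adj_left : (replaceNbrs G a A).Adj a x ↔ x ≠ a ∧ x ∈ A := by
  simp [replaceNbrs, eq_comm]

theorem replaceNbrs_adj_of_ne (hx : x ≠ a) (hy : y ≠ a) :
    (replaceNbrs G a A).Adj x y ↔ G.Adj x y := by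
  simp only [replaceNbrs, hx, hy, if_false, and_iff_right_iff_imp]
  exact fun h => h.ne

end replaceNbrs

/-! ### Counting graphs by resampling. -/

section counting

open scoped Classical

variable {V : Type} [Fintype V]

/-- Replacing the neighborhood of a node by a uniformly random set preserves the uniform
distribution on graphs. -/
theorem sum_sum_replaceNbrs (a : V) (f : SimpleGraph V → ℕ) :
    ∑ G : SimpleGraph V, ∑ A : Finset V, f (replaceNbrs G a A) =
      2 ^ Fintype.card V * ∑ G : SimpleGraph V, f G := by
  -- Exchange `A` with the neighborhood of `a`. Whether `a ∈ A` is invisible in the graph, so this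
  -- bit is carried along to make the map an involution.
  let Φ : SimpleGraph V × Finset V → SimpleGraph V × Finset V := fun p =>
    (replaceNbrs p.1 a p.2,
      Finset.univ.filter fun x => p.1.Adj a x ∨ (x = a ∧ a ∈ p.2))
  have hΦ : Function.Involutive Φ := by
    rintro ⟨G, A⟩
    refine Prod.ext ?_ ?_
    · ext x y
      by_cases hx : x = a
      · subst hx
        simp only [Φ, replaceNbrs_adj_left, Finset.mem_filter, Finset.mem_univ, true_and]
        constructor
        · rintro ⟨hy, h | h⟩
          · exact h
          · exact absurd h.1 hy
        · exact fun h => ⟨h.ne', Or.inl h⟩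
      · by_cases hy : y = a
        · subst hy
          rw [SimpleGraph.adj_comm, G.adj_comm]
          simp only [Φ, replaceNbrs_adj_left, Finset.mem_filter, Finset.mem_univ, true_and]
          constructor
          · rintro ⟨hy, h | h⟩
            · exact h
            · exact absurd h.1 hy
          · exact fun h => ⟨h.ne', Or.inl h⟩
        · simp only [Φ, replaceNbrs_adj_of_ne hx hy]
    · ext x
      simp only [Φ, replaceNbrs_adj_left, Finset.mem_filter, Finset.mem_univ, true_and,
        SimpleGraph.irrefl, false_or]
      by_cases hx : x = a
      · simp [hx]
      · simp [hx]
  have h1 : ∑ p : SimpleGraph V × Finset V, f (Φ p).1 =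
      ∑ p : SimpleGraph V × Finset V, f p.1 :=
    Fintype.sum_equiv hΦ.toPerm _ _ fun p => rfl
  rw [Fintype.sum_prod_type, Fintype.sum_prod_type] at h1
  simp only [Φ, Finset.sum_const, smul_eq_mul, Finset.card_univ, Fintype.card_finset] at h1
  rw [h1, Finset.mul_sum]

/-- A bound on the conditional probability of `p` given `q`, where `q` does not depend on the
neighborhood of `a`. -/
theorem mul_card_le_of_replaceNbrs (a : V) (c : ℕ) (p q : SimpleGraph V → Prop)
    [DecidablePred p] [DecidablePred q]
    (hq : ∀ G A, q (replaceNbrs G a A) → q G)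
    (h : ∀ G, q G → c * (Finset.univ.filter fun A : Finset V => p (replaceNbrs G a A)).card ≤
      2 ^ Fintype.card V) :
    c * (Finset.univ.filter fun G : SimpleGraph V => p G ∧ q G).card ≤
      (Finset.univ.filter fun G : SimpleGraph V => q G).card := by
  have h1 := sum_sum_replaceNbrs a fun G : SimpleGraph V => if p G ∧ q G then 1 else 0
  simp only [Finset.sum_boole, Nat.cast_id] at h1
  refine Nat.le_of_mul_le_mul_left ?_ (Nat.two_pow_pos (Fintype.card V))
  rw [mul_left_comm, ← h1, Finset.mul_sum, Finset.card_filter (fun G : SimpleGraph V => q G),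
    Finset.mul_sum]
  refine Finset.sum_le_sum fun G _ => ?_
  by_cases hG : q G
  · simp only [hG, if_true, mul_one]
    refine le_trans (Nat.mul_le_mul_left c (Finset.card_le_card ?_)) (h G hG)
    exact Finset.monotone_filter_right _ fun A _ hA => hA.1
  · have : (Finset.univ.filter fun A : Finset V =>
        p (replaceNbrs G a A) ∧ q (replaceNbrs G a A)) = ∅ :=
      Finset.filter_eq_empty_iff.2 fun A _ hA => hG (hq G A hA.2)
    simp [this]

theorem mul_card_le_of_replaceNbrs' (a : V) (c : ℕ) (p : SimpleGraph V → Prop)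
    [DecidablePred p]
    (h : ∀ G, c * (Finset.univ.filter fun A : Finset V => p (replaceNbrs G a A)).card ≤
      2 ^ Fintype.card V) :
    c * (Finset.univ.filter fun G : SimpleGraph V => p G).card ≤
      Fintype.card (SimpleGraph V) := by
  simpa using mul_card_le_of_replaceNbrs a c p (fun _ => True) (fun _ _ h => h) fun G _ => h G

/-- The number of sets with a prescribed trace on `T`. -/
theorem card_filter_inter_le (T : Finset V) (S : Finset (Finset V)) :
    (Finset.univ.filter fun A : Finset V => A ∩ T ∈ S).card * 2 ^ T.card ≤
      S.card * 2 ^ Fintype.card V := by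
  have h : (Finset.univ.filter fun A : Finset V => A ∩ T ∈ S).card ≤
      (S ×ˢ (Tᶜ).powerset).card := by
    refine Finset.card_le_card_of_injOn (fun A => (A ∩ T, A ∩ Tᶜ)) ?_ ?_
    · intro A hA
      simp only [Finset.coe_filter, Finset.mem_univ, true_and, Set.mem_ofPred_eq] at hA
      simp [hA]
    · intro A _ B _ hAB
      simp only [Prod.mk.injEq] at hAB
      have := congrArg₂ (· ∪ ·) hAB.1 hAB.2
      simpa [← Finset.inter_union_distrib_left] using this
  calc _ ≤ (S ×ˢ (Tᶜ).powerset).card * 2 ^ T.card := Nat.mul_le_mul_right _ h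
    _ = S.card * 2 ^ (Tᶜ.card + T.card) := by
        rw [Finset.card_product, Finset.card_powerset, pow_add, mul_assoc]
    _ = _ := by rw [Finset.card_compl_add_card]

/-- If the numbers of elements of a random set in all level sets of `g` are prescribed, then one
bit per level set is lost. -/
theorem card_filter_level_le (U : Finset V) (g m : V → ℕ) :
    2 ^ (U.image g).card * (Finset.univ.filter fun A : Finset V =>
      ∀ u ∈ U, (U.filter fun w => w ∈ A ∧ g w = g u).card = m u).card ≤
      2 ^ Fintype.card V := by
  -- `T` has one representative per level. The prescribed counts make `A` recoverable from its part
  -- outside `T`: within a level only the representative is undecided.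
  obtain ⟨T, hTU, hTinj, hT⟩ :=
    Finset.exists_subset_injOn_image_eq_of_surjOn (f := g) (U : Set V) (U.image g)
      (by rw [Finset.coe_image]; exact Set.surjOn_image g U)
  have hcard : (U.image g).card = T.card := by
    rw [← hT, Finset.card_image_of_injOn hTinj]
  have key : ∀ A B : Finset V,
      (∀ u ∈ U, (U.filter fun w => w ∈ A ∧ g w = g u).card = m u) →
      (∀ u ∈ U, (U.filter fun w => w ∈ B ∧ g w = g u).card = m u) →
      A ∩ Tᶜ = B ∩ Tᶜ → A ⊆ B := by
    intro A B hA hB hAB x hxA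
    by_contra hxB
    have hagree : ∀ w, w ∉ T → (w ∈ A ↔ w ∈ B) := fun w hw => by
      have := Finset.ext_iff.1 hAB w
      simpa [hw] using this
    have hxT : x ∈ T := by
      by_contra hxT
      exact hxB ((hagree x hxT).1 hxA)
    have hxU : x ∈ U := hTU hxT
    refine absurd ((hA x hxU).trans (hB x hxU).symm) (ne_of_gt (Finset.card_lt_card ?_))
    refine (Finset.ssubset_iff_of_subset ?_).2 ⟨x, by simp [hxU, hxA], by simp [hxB]⟩
    intro w hw
    simp only [Finset.mem_filter] at hw ⊢
    refine ⟨hw.1, (hagree w fun hwT => ?_).2 hw.2.1, hw.2.2⟩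
    rw [hTinj hwT hxT hw.2.2] at hw
    exact hxB hw.2.1
  have h : (Finset.univ.filter fun A : Finset V =>
      ∀ u ∈ U, (U.filter fun w => w ∈ A ∧ g w = g u).card = m u).card ≤
      (Tᶜ).powerset.card := by
    refine Finset.card_le_card_of_injOn (fun A => A ∩ Tᶜ) ?_ ?_
    · intro A _
      simp
    · intro A hA B hB hAB
      simp only [Finset.coe_filter, Finset.mem_univ, true_and, Set.mem_ofPred_eq] at hA hB
      exact (key A B hA hB hAB).antisymm (key B A hB hA hAB.symm)
  rw [Finset.card_powerset] at h
  calc _ ≤ 2 ^ T.card * 2 ^ (Tᶜ).card := by rw [hcard]; exact Nat.mul_le_mul_left _ h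
    _ = _ := by rw [← pow_add, Finset.card_add_card_compl]

/-- This is the bound `4 ^ m / √(2 * m + 1)` on the central binomial coefficient, with `c` in place
of the root; the squared form goes by induction. -/
theorem mul_centralBinom_le (m c : ℕ) (hc : c ^ 2 ≤ 2 * m + 1) : c * m.centralBinom ≤ 4 ^ m := by
  have h : ∀ m : ℕ, (2 * m + 1) * m.centralBinom ^ 2 ≤ 16 ^ m := by
    intro m
    induction m with
    | zero => simp
    | succ m ih =>
      have h1 := Nat.succ_mul_centralBinom_succ m
      refine Nat.le_of_mul_le_mul_left (c := (m + 1) ^ 2) ?_ (by positivity)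
      calc (m + 1) ^ 2 * ((2 * (m + 1) + 1) * (m + 1).centralBinom ^ 2)
          = (2 * (m + 1) + 1) * ((m + 1) * (m + 1).centralBinom) ^ 2 := by ring
        _ = 4 * ((2 * m + 3) * (2 * m + 1)) * ((2 * m + 1) * m.centralBinom ^ 2) := by
            rw [h1]; ring
        _ ≤ 4 * (4 * (m + 1) ^ 2) * 16 ^ m :=
            Nat.mul_le_mul (Nat.mul_le_mul_left _ (by nlinarith)) ih
        _ = (m + 1) ^ 2 * 16 ^ (m + 1) := by ring
  refine (Nat.pow_le_pow_iff_left (n := 2) two_ne_zero).1 ?_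
  calc (c * m.centralBinom) ^ 2 = c ^ 2 * m.centralBinom ^ 2 := by ring
    _ ≤ (2 * m + 1) * m.centralBinom ^ 2 := Nat.mul_le_mul_right _ hc
    _ ≤ 16 ^ m := h m
    _ = (4 ^ m) ^ 2 := by rw [← pow_mul, mul_comm, pow_mul]; norm_num

/-- Resample at `x`. The possible edge `xy` counts equally in both degrees, so a coincidence fixes
the size of the random set on the other `2 * m` nodes, and the central binomial coefficient bounds
the number of choices there. -/
theorem mul_card_degree_eq_le {m c : ℕ} (hV : Fintype.card V = 2 * m + 2)
    (hc : c ^ 2 ≤ 2 * m + 1) {x y : V} (hxy : x ≠ y) :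
    c * (Finset.univ.filter fun G : SimpleGraph V => (nbrs G x).card = (nbrs G y).card).card ≤
      Fintype.card (SimpleGraph V) := by
  refine mul_card_le_of_replaceNbrs' x c (fun G => (nbrs G x).card = (nbrs G y).card) fun G => ?_
  let T : Finset V := ({x, y} : Finset V)ᶜ
  have hT : T.card = 2 * m := by
    rw [Finset.card_compl, hV, Finset.card_pair hxy]; rfl
  let d := (nbrs G y ∩ T).card
  have hsub : ∀ A : Finset V, (nbrs (replaceNbrs G x A) x).card =
      (nbrs (replaceNbrs G x A) y).card → A ∩ T ∈ T.powersetCard d := by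
    intro A hA
    simp only [Finset.mem_powersetCard, Finset.inter_subset_right, true_and]
    have h1 : nbrs (replaceNbrs G x A) x = (A ∩ T) ∪ (if y ∈ A then {y} else ∅) := by
      ext z
      rw [mem_nbrs, replaceNbrs_adj_left]
      by_cases hz : z = y <;> by_cases hy : y ∈ A <;> simp_all [T, eq_comm] <;> tauto
    have h2 : nbrs (replaceNbrs G x A) y = (nbrs G y ∩ T) ∪ (if y ∈ A then {x} else ∅) := by
      ext z
      rw [mem_nbrs]
      by_cases hz : z = x
      · subst hz
        rw [SimpleGraph.adj_comm, replaceNbrs_adj_left]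
        by_cases hy : y ∈ A <;> simp [T, hy, hxy.symm]
      · rw [replaceNbrs_adj_of_ne hxy.symm hz]
        by_cases hzy : z = y
        · subst hzy
          by_cases hy : z ∈ A <;> simp [T, hy, hz]
        · by_cases hy : y ∈ A <;> simp [T, hy, hz, hzy, mem_nbrs]
    rw [h1, h2] at hA
    by_cases hy : y ∈ A
    · rw [if_pos hy, if_pos hy, Finset.card_union_of_disjoint (by simp [T]),
        Finset.card_union_of_disjoint (by simp [T])] at hA
      simpa using hA
    · simpa [hy] using hA
  have h2 := card_filter_inter_le T (T.powersetCard d)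
  have h3 := mul_centralBinom_le m c hc
  have h4 : (T.powersetCard d).card ≤ m.centralBinom := by
    rw [Finset.card_powersetCard, hT, Nat.centralBinom_eq_two_mul_choose]
    exact Nat.choose_le_centralBinom d m
  rw [hT, pow_mul] at h2
  refine Nat.le_of_mul_le_mul_right (c := 4 ^ m) ?_ (by positivity)
  refine le_trans (Nat.mul_le_mul_right _ (Nat.mul_le_mul_left _ (Finset.card_le_card
    (t := Finset.univ.filter fun A : Finset V => A ∩ T ∈ T.powersetCard d) fun A hA =>
      Finset.mem_filter.2 ⟨Finset.mem_univ A, hsub A (Finset.mem_filter.1 hA).2⟩))) ?_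
  calc c * (Finset.univ.filter fun A : Finset V => A ∩ T ∈ T.powersetCard d).card * 4 ^ m
      = c * ((Finset.univ.filter fun A : Finset V =>
          A ∩ T ∈ T.powersetCard d).card * (2 ^ 2) ^ m) := by norm_num [mul_assoc]
    _ ≤ c * ((T.powersetCard d).card * 2 ^ Fintype.card V) := Nat.mul_le_mul_left _ h2
    _ ≤ c * (m.centralBinom * 2 ^ Fintype.card V) :=
        Nat.mul_le_mul_left _ (Nat.mul_le_mul_right _ h4)
    _ = c * m.centralBinom * 2 ^ Fintype.card V := by ring
    _ ≤ 4 ^ m * 2 ^ Fintype.card V := Nat.mul_le_mul_right _ h3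
    _ = _ := mul_comm _ _

/-- Induction on `X`: since `X` and `Y` are disjoint, resampling at a new node leaves the earlier
conditions intact, and its trace on `Y` is forced to be `Y` or `∅`. -/
theorem mul_card_adj_iff_le (p : Prop) (Y X : Finset V) (hXY : Disjoint X Y) :
    2 ^ (X.card * Y.card) * (Finset.univ.filter fun G : SimpleGraph V =>
      ∀ x ∈ X, ∀ y ∈ Y, (G.Adj x y ↔ p)).card ≤ Fintype.card (SimpleGraph V) := by
  induction X using Finset.induction_on with
  | empty => simp
  | insert x X hx ih =>
    rw [Finset.disjoint_insert_left] at hXY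
    have h := mul_card_le_of_replaceNbrs x (2 ^ Y.card)
      (fun G : SimpleGraph V => ∀ y ∈ Y, (G.Adj x y ↔ p))
      (fun G => ∀ z ∈ X, ∀ y ∈ Y, (G.Adj z y ↔ p)) ?_ ?_
    · simp only [Finset.forall_mem_insert]
      rw [Finset.card_insert_of_notMem hx, add_mul, one_mul, pow_add, mul_assoc]
      refine le_trans (Nat.mul_le_mul_left _ ?_) (ih hXY.2)
      convert h
    · intro G A h z hz y hy
      rw [← h z hz y hy, replaceNbrs_adj_of_ne]
      · rintro rfl; exact hx hz
      · rintro rfl; exact hXY.1 hy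
    · intro G _
      have h := card_filter_inter_le Y {if p then Y else ∅}
      rw [Finset.card_singleton, one_mul] at h
      rw [mul_comm]
      refine le_trans (Nat.mul_le_mul_right _ (Finset.card_le_card ?_)) h
      intro A hA
      simp only [Finset.mem_filter, Finset.mem_univ, true_and, Finset.mem_singleton,
        replaceNbrs_adj_left] at hA ⊢
      ext y
      by_cases hy : y ∈ Y
      · have hyx : y ≠ x := by rintro rfl; exact hXY.1 hy
        have := hA y hy
        by_cases hp : p <;> simp_all
      · by_cases hp : p <;> simp_all

end counting

/-! ### Distinct colors in round 1 and concentration of degrees. -/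

section counting

open scoped Classical

variable {V : Type} [Fintype V]

/-- The number of neighbors of `u` other than `a` and `b`. -/
noncomputable def degreeOff (G : SimpleGraph V) (a b u : V) : ℕ :=
  (nbrs G u \ {a, b}).card

theorem card_nbrs_eq_degreeOff_add (G : SimpleGraph V) {a b : V} (hab : a ≠ b) (u : V) :
    (nbrs G u).card =
      degreeOff G a b u + ((if G.Adj a u then 1 else 0) + (if G.Adj b u then 1 else 0)) := by
  rw [degreeOff, ← Finset.card_sdiff_add_card_inter (nbrs G u) {a, b}]
  congr 1
  rw [Finset.inter_comm, ← Finset.filter_mem_eq_inter, Finset.card_filter, Finset.sum_pair hab]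
  simp only [mem_nbrs, G.adj_comm u]

theorem card_filter_nbrs_eq_of_refineColor_one_eq {G : SimpleGraph V} {a b : V}
    (h : refineColor G 1 a = refineColor G 1 b) (j : ℕ) :
    ((nbrs G a).filter fun u => (nbrs G u).card = j).card =
      ((nbrs G b).filter fun u => (nbrs G u).card = j).card := by
  have h2 := congrArg (Multiset.count j) (refineColor_succ_eq_iff.1 h).2
  rw [Multiset.count_map, Multiset.count_map] at h2
  simp only [eq_comm (a := j)] at h2
  exact h2

theorem card_filter_nbrs_split (G : SimpleGraph V) {a b : V} (j : ℕ) :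
    ((nbrs G a).filter fun u => (nbrs G u).card = j).card =
      ((({a, b} : Finset V)ᶜ).filter fun u => G.Adj a u ∧ (nbrs G u).card = j).card +
        if G.Adj a b ∧ (nbrs G b).card = j then 1 else 0 := by
  have : ((nbrs G a).filter fun u => (nbrs G u).card = j) =
      ((({a, b} : Finset V)ᶜ).filter fun u => G.Adj a u ∧ (nbrs G u).card = j) ∪
        if G.Adj a b ∧ (nbrs G b).card = j then {b} else ∅ := by
    ext u
    by_cases hb : u = b
    · subst hb
      split_ifs with h <;> simp [mem_nbrs, h]
    · by_cases ha : u = a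
      · subst ha
        split_ifs with h <;> simp [mem_nbrs, hb]
      · split_ifs with h <;> simp [mem_nbrs, ha, hb]
  rw [this, Finset.card_union_of_disjoint]
  · split_ifs <;> simp
  · split_ifs <;> simp

/-- This turns equal colors into a condition on level sets of `degreeOff`, which do not move when
the neighborhood of `a` is resampled. Common neighbors and the edge `ab` contribute equally to both
sides, so only nodes adjacent to exactly one of `a`, `b` matter. -/
theorem card_filter_degreeOff_eq {G : SimpleGraph V} {a b : V} (hab : a ≠ b)
    (h : refineColor G 1 a = refineColor G 1 b) (k : ℕ) :
    ((({a, b} : Finset V)ᶜ).filter fun u => G.Adj a u ∧ degreeOff G a b u = k).card =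
      ((({a, b} : Finset V)ᶜ).filter fun u => G.Adj b u ∧ degreeOff G a b u = k).card := by
  set U : Finset V := ({a, b} : Finset V)ᶜ with hU
  have hdeg : (nbrs G a).card = (nbrs G b).card := (refineColor_succ_eq_iff.1 h).1
  -- A node of `U` adjacent to exactly one of `a`, `b` has degree `k + 1` precisely when its
  -- `degreeOff` is `k`.
  have h1 : (U.filter fun u => G.Adj a u ∧ (nbrs G u).card = k + 1).card =
      (U.filter fun u => G.Adj b u ∧ (nbrs G u).card = k + 1).card := by
    have h2 := card_filter_nbrs_eq_of_refineColor_one_eq h (k + 1)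
    rw [card_filter_nbrs_split G (a := a) (b := b), card_filter_nbrs_split G (a := b) (b := a),
      Finset.pair_comm b a, hdeg, G.adj_comm b a] at h2
    exact Nat.add_right_cancel h2
  have split : ∀ x y : V, x = a ∧ y = b ∨ x = b ∧ y = a →
      (U.filter fun u => G.Adj x u ∧ (nbrs G u).card = k + 1).card =
        (U.filter fun u => G.Adj x u ∧ ¬ G.Adj y u ∧ degreeOff G a b u = k).card +
        (U.filter fun u => G.Adj a u ∧ G.Adj b u ∧ degreeOff G a b u + 1 = k).card := by
    intro x y hxy
    rw [← Finset.card_union_of_disjoint]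
    · congr 1
      ext u
      simp only [Finset.mem_union, Finset.mem_filter, card_nbrs_eq_degreeOff_add G hab u]
      rcases hxy with ⟨rfl, rfl⟩ | ⟨rfl, rfl⟩ <;> by_cases h1 : G.Adj x u <;>
        by_cases h2 : G.Adj y u <;> simp [h1, h2]
    · rw [Finset.disjoint_filter]
      rcases hxy with ⟨rfl, rfl⟩ | ⟨rfl, rfl⟩ <;> tauto
  have split' : ∀ x y : V, x = a ∧ y = b ∨ x = b ∧ y = a →
      (U.filter fun u => G.Adj x u ∧ degreeOff G a b u = k).card =
        (U.filter fun u => G.Adj x u ∧ ¬ G.Adj y u ∧ degreeOff G a b u = k).card +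
        (U.filter fun u => G.Adj a u ∧ G.Adj b u ∧ degreeOff G a b u = k).card := by
    intro x y hxy
    rw [← Finset.card_union_of_disjoint]
    · congr 1
      ext u
      simp only [Finset.mem_union, Finset.mem_filter]
      rcases hxy with ⟨rfl, rfl⟩ | ⟨rfl, rfl⟩ <;> tauto
    · rw [Finset.disjoint_filter]
      rcases hxy with ⟨rfl, rfl⟩ | ⟨rfl, rfl⟩ <;> tauto
  have s1 := split a b (Or.inl ⟨rfl, rfl⟩)
  have s2 := split b a (Or.inr ⟨rfl, rfl⟩)
  have s3 := split' a b (Or.inl ⟨rfl, rfl⟩)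
  have s4 := split' b a (Or.inr ⟨rfl, rfl⟩)
  omega

/-- Two nodes rarely have the same color of round `1` if there are many different degrees. -/
theorem mul_card_refineColor_one_eq_le (R : ℕ) {a b : V} (hab : a ≠ b) :
    2 ^ R * (Finset.univ.filter fun G : SimpleGraph V =>
      refineColor G 1 a = refineColor G 1 b ∧
        R ≤ ((({a, b} : Finset V)ᶜ).image (degreeOff G a b)).card).card ≤
      Fintype.card (SimpleGraph V) := by
  set U : Finset V := ({a, b} : Finset V)ᶜ with hU
  have hmem : ∀ u ∈ U, u ≠ a ∧ u ≠ b := fun u hu => by simpa [hU] using hu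
  have hoff : ∀ (G : SimpleGraph V) (A : Finset V), ∀ u ∈ U,
      degreeOff (replaceNbrs G a A) a b u = degreeOff G a b u := by
    intro G A u hu
    unfold degreeOff
    congr 1
    ext w
    simp only [Finset.mem_sdiff, mem_nbrs, Finset.mem_insert, Finset.mem_singleton, not_or]
    constructor
    · rintro ⟨h, hwa, hwb⟩
      exact ⟨(replaceNbrs_adj_of_ne (hmem u hu).1 hwa).1 h, hwa, hwb⟩
    · rintro ⟨h, hwa, hwb⟩
      exact ⟨(replaceNbrs_adj_of_ne (hmem u hu).1 hwa).2 h, hwa, hwb⟩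
  refine mul_card_le_of_replaceNbrs' a (2 ^ R) (fun G => refineColor G 1 a = refineColor G 1 b ∧
        R ≤ (U.image (degreeOff G a b)).card) fun G => ?_
  have himg : ∀ A, U.image (degreeOff (replaceNbrs G a A) a b) = U.image (degreeOff G a b) :=
    fun A => Finset.image_congr fun u hu => hoff G A u hu
  simp only [himg]
  by_cases hR : R ≤ (U.image (degreeOff G a b)).card
  -- The neighborhood of `b` within `U` is unaffected by resampling at `a`, so equal colors
  -- prescribe one count per level.
  · refine le_trans (Nat.mul_le_mul (Nat.pow_le_pow_right two_pos hR) (Finset.card_le_card ?_))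
      (card_filter_level_le U (degreeOff G a b) fun u =>
        (U.filter fun w => G.Adj b w ∧ degreeOff G a b w = degreeOff G a b u).card)
    intro A hA
    simp only [Finset.mem_filter, Finset.mem_univ, true_and, hR, and_true] at hA ⊢
    intro u _
    have h := card_filter_degreeOff_eq hab hA (degreeOff G a b u)
    rw [← hU] at h
    convert h using 2
    · refine Finset.filter_congr fun w hw => ?_
      rw [hoff G A w hw, replaceNbrs_adj_left]
      simp [(hmem w hw).1]
    · refine Finset.filter_congr fun w hw => ?_
      rw [hoff G A w hw, replaceNbrs_adj_of_ne hab.symm (hmem w hw).1]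
  · simp [hR]

/-- If many nodes have different degrees, then many degrees remain when two nodes are removed. -/
theorem le_card_image_degreeOff {G : SimpleGraph V} {T : Finset V} {R : ℕ}
    (hT : 3 * R + 2 ≤ T.card)
    (hinj : ∀ x ∈ T, ∀ y ∈ T, (nbrs G x).card = (nbrs G y).card → x = y) {a b : V}
    (hab : a ≠ b) : R ≤ ((({a, b} : Finset V)ᶜ).image (degreeOff G a b)).card := by
  set S := T \ {a, b} with hS
  have hST : S ⊆ ({a, b} : Finset V)ᶜ := fun u hu => by
    simp only [hS, Finset.mem_sdiff] at hu
    simpa using hu.2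
  have hScard : 3 * R ≤ S.card := by
    rw [hS]
    have h1 := Finset.le_card_sdiff ({a, b} : Finset V) T
    rw [Finset.card_pair hab] at h1
    omega
  -- Degrees exceed `degreeOff` by 0, 1 or 2, so at most three nodes with distinct degrees share a
  -- level.
  have h3 : S.card ≤ 3 * (S.image (degreeOff G a b)).card := by
    refine Finset.card_le_mul_card_image S 3 fun k _ => ?_
    refine le_trans (Finset.card_le_card_of_injOn (t := Finset.Icc k (k + 2))
      (fun u => (nbrs G u).card) ?_ ?_)
      (by rw [Nat.card_Icc]; omega)
    · intro u hu
      simp only [Finset.coe_filter, Set.mem_ofPred_eq] at hu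
      simp only [Finset.coe_Icc, Set.mem_Icc, card_nbrs_eq_degreeOff_add G hab u, hu.2]
      split_ifs <;> omega
    · intro u hu w hw huw
      simp only [Finset.coe_filter, Set.mem_ofPred_eq, hS, Finset.mem_sdiff] at hu hw
      exact hinj u hu.1.1 w hw.1.1 huw
  have h4 : (S.image (degreeOff G a b)).card ≤ _ :=
    Finset.card_le_card (Finset.image_subset_image hST)
  omega

/-- The variance of a binomial variable, doubled before squaring to stay integral. Pairing `A` with
`insert a A` cancels the cross terms. -/
theorem sum_powerset_sq_sub {α : Type} (S : Finset α) :
    ∑ A ∈ S.powerset, (2 * (A.card : ℤ) - S.card) ^ 2 = (S.card * 2 ^ S.card : ℤ) := by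
  induction S using Finset.induction_on with
  | empty => simp
  | insert a S ha ih =>
    rw [Finset.sum_powerset_insert ha, ← Finset.sum_add_distrib, Finset.card_insert_of_notMem ha]
    have : ∀ A ∈ S.powerset, (2 * (A.card : ℤ) - (S.card + 1 : ℕ)) ^ 2 +
        (2 * ((insert a A).card : ℤ) - (S.card + 1 : ℕ)) ^ 2 =
        2 * (2 * (A.card : ℤ) - S.card) ^ 2 + 2 := by
      intro A hA
      rw [Finset.card_insert_of_notMem fun h => ha (Finset.mem_powerset.1 hA h)]
      push_cast
      ring
    rw [Finset.sum_congr rfl this, Finset.sum_add_distrib, ← Finset.mul_sum, ih]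
    simp
    ring

/-- Twice the deviation of the degree of `x` from its mean in the random graph. -/
noncomputable def degreeDev (G : SimpleGraph V) (x : V) : ℕ :=
  (2 * ((nbrs G x).card : ℤ) - (Fintype.card V - 1 : ℕ)).natAbs

theorem sum_degreeDev_sq (x : V) :
    ∑ G : SimpleGraph V, degreeDev G x ^ 2 =
      (Fintype.card V - 1) * Fintype.card (SimpleGraph V) := by
  have h := sum_sum_replaceNbrs x fun G => degreeDev G x ^ 2
  have hS : (({x} : Finset V)ᶜ).card = Fintype.card V - 1 := by simp [Finset.card_compl]
  have hV : Fintype.card V = (Fintype.card V - 1) + 1 := by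
    have : 0 < Fintype.card V := Fintype.card_pos_iff.2 ⟨x⟩
    omega
  have h1 : ∀ G : SimpleGraph V, ∑ A : Finset V, degreeDev (replaceNbrs G x A) x ^ 2 =
      (Fintype.card V - 1) * 2 ^ Fintype.card V := by
    intro G
    have hn : ∀ A, nbrs (replaceNbrs G x A) x = A.erase x := fun A => by
      ext u
      rw [mem_nbrs, replaceNbrs_adj_left, Finset.mem_erase]
    have hx : x ∉ ({x} : Finset V)ᶜ := by simp
    have hu : (Finset.univ : Finset (Finset V)) = (insert x ({x} : Finset V)ᶜ).powerset := by
      ext A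
      simp only [Finset.mem_univ, Finset.mem_powerset, true_iff]
      intro u _
      by_cases hu : u = x <;> simp [hu]
    have h2 := sum_powerset_sq_sub ({x} : Finset V)ᶜ
    rw [hS] at h2
    zify
    simp only [degreeDev, hn, Int.natCast_natAbs, sq_abs]
    rw [hu, Finset.sum_powerset_insert hx]
    have h3 : ∀ A ∈ (({x} : Finset V)ᶜ).powerset,
        (2 * ((A.erase x).card : ℤ) - (Fintype.card V - 1 : ℕ)) ^ 2 =
          (2 * (A.card : ℤ) - (Fintype.card V - 1 : ℕ)) ^ 2 := fun A hA => by
      rw [Finset.erase_eq_of_notMem fun h => hx (Finset.mem_powerset.1 hA h)]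
    have h4 : ∀ A ∈ (({x} : Finset V)ᶜ).powerset,
        (2 * (((insert x A).erase x).card : ℤ) - (Fintype.card V - 1 : ℕ)) ^ 2 =
          (2 * (A.card : ℤ) - (Fintype.card V - 1 : ℕ)) ^ 2 := fun A hA => by
      rw [Finset.erase_insert fun h => hx (Finset.mem_powerset.1 hA h)]
    rw [Finset.sum_congr rfl h3, Finset.sum_congr rfl h4, h2]
    generalize Fintype.card V - 1 = m at hV ⊢
    rw [hV]
    ring
  simp only [h1, Finset.sum_const, Finset.card_univ, smul_eq_mul] at h
  refine Nat.eq_of_mul_eq_mul_left (Nat.two_pow_pos (Fintype.card V)) ?_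
  rw [← h]
  ring

/-- Markov's inequality: the squared deviations of a graph sum to less than `N ^ 2` on average, but
to at least `(N / 8) * 64 * N` in a graph counted here. -/
theorem mul_card_degreeDev_le [Nonempty V] :
    8 * (Finset.univ.filter fun G : SimpleGraph V => Fintype.card V ≤
      8 * (Finset.univ.filter fun x => 64 * Fintype.card V ≤ degreeDev G x ^ 2).card).card ≤
      Fintype.card (SimpleGraph V) := by
  have hpos : 0 < Fintype.card V := Fintype.card_pos
  set N := Fintype.card V
  set M := Fintype.card (SimpleGraph V)
  set B := Finset.univ.filter fun G : SimpleGraph V => N ≤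
      8 * (Finset.univ.filter fun x => 64 * N ≤ degreeDev G x ^ 2).card
  have h1 : ∑ G : SimpleGraph V, ∑ x : V, degreeDev G x ^ 2 = N * ((N - 1) * M) := by
    rw [Finset.sum_comm]
    simp [sum_degreeDev_sq, N, M]
  have h2 : ∀ G ∈ B, 8 * N * N ≤ ∑ x : V, degreeDev G x ^ 2 := by
    intro G hG
    have hG' := (Finset.mem_filter.1 hG).2
    calc 8 * N * N ≤ (Finset.univ.filter fun x => 64 * N ≤ degreeDev G x ^ 2).card * (64 * N) := by
          nlinarith
      _ = ∑ x ∈ Finset.univ.filter fun x => 64 * N ≤ degreeDev G x ^ 2, 64 * N := by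
          rw [Finset.sum_const, smul_eq_mul]
      _ ≤ ∑ x ∈ Finset.univ.filter fun x => 64 * N ≤ degreeDev G x ^ 2, degreeDev G x ^ 2 :=
          Finset.sum_le_sum fun x hx => (Finset.mem_filter.1 hx).2
      _ ≤ _ := Finset.sum_le_sum_of_subset (Finset.filter_subset _ _)
  have h3 : B.card * (8 * N * N) ≤ N * ((N - 1) * M) := by
    rw [← h1, ← smul_eq_mul, ← Finset.sum_const]
    exact (Finset.sum_le_sum h2).trans (Finset.sum_le_sum_of_subset (Finset.subset_univ _))
  refine Nat.le_of_mul_le_mul_left (c := N * N) ?_ (by positivity)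
  calc N * N * (8 * B.card) = B.card * (8 * N * N) := by ring
    _ ≤ N * ((N - 1) * M) := h3
    _ ≤ N * (N * M) := Nat.mul_le_mul_left _ (Nat.mul_le_mul_right _ (Nat.sub_le _ _))
    _ = N * N * M := by ring

theorem mul_card_exists_le {ι : Type} (I : Finset ι) (c : ℕ) (p : ι → SimpleGraph V → Prop)
    [∀ i, DecidablePred (p i)] [DecidablePred fun G => ∃ i ∈ I, p i G]
    (h : ∀ i ∈ I, c * (Finset.univ.filter fun G => p i G).card ≤ Fintype.card (SimpleGraph V)) :
    c * (Finset.univ.filter fun G => ∃ i ∈ I, p i G).card ≤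
      I.card * Fintype.card (SimpleGraph V) := by
  have h1 : (Finset.univ.filter fun G => ∃ i ∈ I, p i G) ⊆
      I.biUnion fun i => Finset.univ.filter fun G => p i G := by
    intro G hG
    simpa using hG
  calc _ ≤ c * ∑ i ∈ I, (Finset.univ.filter fun G => p i G).card :=
        Nat.mul_le_mul_left _ ((Finset.card_le_card h1).trans Finset.card_biUnion_le)
    _ ≤ _ := by
        rw [Finset.mul_sum, ← smul_eq_mul, ← Finset.sum_const]
        exact Finset.sum_le_sum h

end counting

/-! ### Switching edges. -/

theorem Finset.map_insert_erase_val {α β : Type} [DecidableEq α] {s : Finset α} {x y : α}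
    (hx : x ∈ s) (hy : y ∉ s) {f : α → β} (h : f x = f y) :
    (insert y (s.erase x)).val.map f = s.val.map f := by
  rw [Finset.insert_val_of_notMem fun h => hy (Finset.mem_of_mem_erase h), Finset.erase_val,
    Multiset.map_cons, ← h, ← Multiset.map_cons, Multiset.cons_erase hx]

section switch

variable {V : Type}

/-- The graph `G` with the edges `ab` and `cd` replaced by `ad` and `cb`. -/
def switchEdges (G : SimpleGraph V) (a b c d : V) (had : a ≠ d) (hcb : c ≠ b) :
    SimpleGraph V where
  Adj x y := (G.Adj x y ∧ s(x, y) ≠ s(a, b) ∧ s(x, y) ≠ s(c, d)) ∨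
    s(x, y) = s(a, d) ∨ s(x, y) = s(c, b)
  symm := ⟨fun x y h => by rwa [G.adj_comm, Sym2.eq_swap]⟩
  loopless := ⟨fun x h => by
    simp only [SimpleGraph.irrefl, false_and, false_or, Sym2.eq_iff] at h
    grind⟩

variable [Fintype V] {G : SimpleGraph V} {a b c d : V}

open scoped Classical in
theorem nbrs_switchEdges (hab : G.Adj a b) (hcd : G.Adj c d) (had' : a ≠ d)
    (hcb' : c ≠ b) (hac : a ≠ c) (hbd : b ≠ d) :
    nbrs (switchEdges G a b c d had' hcb') a = insert d ((nbrs G a).erase b) ∧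
    nbrs (switchEdges G a b c d had' hcb') b = insert c ((nbrs G b).erase a) ∧
    nbrs (switchEdges G a b c d had' hcb') c = insert b ((nbrs G c).erase d) ∧
    nbrs (switchEdges G a b c d had' hcb') d = insert a ((nbrs G d).erase c) ∧
    ∀ x, x ≠ a → x ≠ b → x ≠ c → x ≠ d →
      nbrs (switchEdges G a b c d had' hcb') x = nbrs G x := by
  have hab' := hab.ne
  have hcd' := hcd.ne
  refine ⟨?_, ?_, ?_, ?_, fun x _ _ _ _ => ?_⟩ <;> ext y <;>
    simp only [mem_nbrs, switchEdges, Finset.mem_insert, Finset.mem_erase, Sym2.eq_iff] <;>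
    grind [SimpleGraph.adj_comm]

/-- Switching the edges of an alternating 4-cycle with suitable degrees far from `v` does not
change the color of `v` in round `3`, but in round `4`. -/
theorem exists_refineColor_three_eq_four_ne (hinj : Function.Injective (refineColor G 1))
    (hab : G.Adj a b) (hcd : G.Adj c d) (had : ¬ G.Adj a d) (hcb : ¬ G.Adj c b)
    (had' : a ≠ d) (hcb' : c ≠ b) (hdac : (nbrs G a).card = (nbrs G c).card)
    (hdbd : (nbrs G b).card = (nbrs G d).card) {v u : V}
    (hv : ∀ x, x = a ∨ x = b ∨ x = c ∨ x = d → x ≠ v ∧ ¬ G.Adj v x)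
    (hvu : G.Adj v u) (hua : G.Adj u a) :
    ∃ H : SimpleGraph V, refineColor G 3 v = refineColor H 3 v ∧
      refineColor G 4 v ≠ refineColor H 4 v := by
  classical
  have hac : a ≠ c := by rintro rfl; exact hcb hab
  have hbd : b ≠ d := by rintro rfl; exact had hab
  obtain ⟨na, nb, nc, nd, nx⟩ := nbrs_switchEdges hab hcd had' hcb' hac hbd
  set H := switchEdges G a b c d had' hcb'
  -- Each endpoint trades a neighbor for one of the same degree.
  have hmap : ∀ x, (nbrs H x).val.map (refineColor G 0) = (nbrs G x).val.map (refineColor G 0) := by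
    intro x
    by_cases hxa : x = a
    · rw [hxa, na]
      exact Finset.map_insert_erase_val (mem_nbrs.2 hab) (mt mem_nbrs.1 had) hdbd
    by_cases hxb : x = b
    · rw [hxb, nb]
      exact Finset.map_insert_erase_val (mem_nbrs.2 hab.symm)
        (mt mem_nbrs.1 fun h => hcb h.symm) hdac
    by_cases hxc : x = c
    · rw [hxc, nc]
      exact Finset.map_insert_erase_val (mem_nbrs.2 hcd) (mt mem_nbrs.1 hcb) hdbd.symm
    by_cases hxd : x = d
    · rw [hxd, nd]
      exact Finset.map_insert_erase_val (mem_nbrs.2 hcd.symm)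
        (mt mem_nbrs.1 fun h => had h.symm) hdac.symm
    rw [nx x hxa hxb hxc hxd]
  have c0 : refineColor H 0 = refineColor G 0 := by
    funext x
    simpa [refineColor] using congrArg Multiset.card (hmap x)
  have c1 : refineColor H 1 = refineColor G 1 := by
    funext x
    rw [refineColor_succ_eq_iff, c0]
    exact ⟨rfl, hmap x⟩
  have c2 : ∀ x, x ≠ a → x ≠ b → x ≠ c → x ≠ d → refineColor H 2 x = refineColor G 2 x := by
    intro x hxa hxb hxc hxd
    rw [refineColor_succ_eq_iff, c1, nx x hxa hxb hxc hxd]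
    exact ⟨rfl, rfl⟩
  have nv : nbrs H v = nbrs G v :=
    nx v (hv a (by simp)).1.symm (hv b (by simp)).1.symm (hv c (by simp)).1.symm
      (hv d (by simp)).1.symm
  refine ⟨H, ?_, fun h4 => ?_⟩
  · rw [eq_comm, refineColor_succ_eq_iff, nv]
    refine ⟨c2 v (hv a (by simp)).1.symm (hv b (by simp)).1.symm (hv c (by simp)).1.symm
      (hv d (by simp)).1.symm, Multiset.map_congr rfl fun x hx => ?_⟩
    have hx' : G.Adj v x := mem_nbrs.1 hx
    refine c2 x ?_ ?_ ?_ ?_ <;> rintro rfl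
    · exact (hv x (by simp)).2 hx'
    · exact (hv x (by simp)).2 hx'
    · exact (hv x (by simp)).2 hx'
    · exact (hv x (by simp)).2 hx'
  -- Follow the path `v`, `u`, `a` inside the colors: some node of `H` has in round 2 the color of
  -- `a` in `G`. By injectivity it is `a` itself, with unchanged neighbors, contradicting the new
  -- edge `ad`.
  · have h1 := (refineColor_succ_eq_iff.1 h4).2
    have hu : refineColor G 3 u ∈ (nbrs H v).val.map (refineColor H 3) := by
      rw [← h1]
      exact Multiset.mem_map_of_mem _ (mem_nbrs.2 hvu)
    obtain ⟨u', _, hu'⟩ := Multiset.mem_map.1 hu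
    have h2 := (refineColor_succ_eq_iff.1 hu').2
    have ha : refineColor G 2 a ∈ (nbrs H u').val.map (refineColor H 2) := by
      rw [h2]
      exact Multiset.mem_map_of_mem _ (mem_nbrs.2 hua)
    obtain ⟨w, _, hw⟩ := Multiset.mem_map.1 ha
    obtain ⟨hw1, hw2⟩ := refineColor_succ_eq_iff.1 hw
    rw [c1] at hw1 hw2
    obtain rfl := hinj hw1
    have h3 := Multiset.map_injective hinj hw2
    have hd : d ∈ (nbrs H w).val := by rw [na]; exact Finset.mem_insert_self _ _
    rw [h3] at hd
    exact had (mem_nbrs.1 hd)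

end switch

/-! ### Finding a switch in a typical graph. -/

section typical

variable {V : Type} {G : SimpleGraph V} {t : ℕ}

/-- There are neither complete nor empty bipartite subgraphs with `t` nodes on each side. -/
def NoHomogeneousPair (G : SimpleGraph V) (t : ℕ) : Prop :=
  ∀ (p : Prop) (X Y : Finset V), Disjoint X Y → X.card = t → Y.card = t →
    ¬ ∀ x ∈ X, ∀ y ∈ Y, (G.Adj x y ↔ p)

/-- Without an alternating 4-cycle between halves `A` and `B`, neighborhoods in `B` form a chain. If
`t` nodes of `A` have at least `t` neighbors each, the smallest neighborhood is common to them;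
otherwise `t` nodes all miss the complement of the largest. Both give a homogeneous pair. -/
theorem NoHomogeneousPair.exists_alternating (hG : NoHomogeneousPair G t) (ht : 0 < t)
    {S : Finset V} (hS : 4 * t ≤ S.card) :
    ∃ a ∈ S, ∃ b ∈ S, ∃ c ∈ S, ∃ d ∈ S, G.Adj a b ∧ G.Adj c d ∧ ¬ G.Adj a d ∧ ¬ G.Adj c b ∧
      a ≠ d ∧ c ≠ b := by
  classical
  obtain ⟨A, hAS, hA⟩ := Finset.exists_subset_card_eq (show 2 * t ≤ S.card by omega)
  obtain ⟨B, hBS, hB⟩ := Finset.exists_subset_card_eq (s := S \ A) (n := 2 * t) (by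
    rw [Finset.card_sdiff_of_subset hAS]; omega)
  have hAB : Disjoint A B := Finset.disjoint_of_subset_right hBS Finset.disjoint_sdiff
  have hBS' : B ⊆ S := hBS.trans Finset.sdiff_subset
  by_contra hno
  let f : V → Finset V := fun x => B.filter fun y => G.Adj x y
  have hchain : ∀ x ∈ A, ∀ z ∈ A, (f x).card ≤ (f z).card → f x ⊆ f z := by
    intro x hx z hz hxz
    by_contra hsub
    obtain ⟨y, hy, hyz⟩ := Finset.not_subset.1 hsub
    have hsub' : ¬ f z ⊆ f x := fun h => hyz (Finset.eq_of_subset_of_card_le h hxz ▸ hy)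
    obtain ⟨w, hw, hwx⟩ := Finset.not_subset.1 hsub'
    simp only [f, Finset.mem_filter, not_and] at hy hyz hw hwx
    refine hno ⟨x, hAS hx, y, hBS' hy.1, z, hAS hz, w, hBS' hw.1, hy.2, hw.2, hwx hw.1, hyz hy.1,
      ?_, ?_⟩
    · rintro rfl; exact Finset.disjoint_left.1 hAB hx hw.1
    · rintro rfl; exact Finset.disjoint_left.1 hAB hz hy.1
  have hsplit := Finset.card_filter_add_card_filter_not (s := A) fun x => t ≤ (f x).card
  by_cases hbig : t ≤ (A.filter fun x => t ≤ (f x).card).card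
  · obtain ⟨X, hX, hXt⟩ := Finset.exists_subset_card_eq hbig
    obtain ⟨z, hz, hmin⟩ := Finset.exists_min_image X (fun x => (f x).card)
      (Finset.card_pos.1 (by omega))
    obtain ⟨Y, hY, hYt⟩ := Finset.exists_subset_card_eq (Finset.mem_filter.1 (hX hz)).2
    refine hG True X Y ?_ hXt hYt fun x hx y hy => ?_
    · exact Finset.disjoint_of_subset_left (hX.trans (Finset.filter_subset _ _))
        (Finset.disjoint_of_subset_right (hY.trans (Finset.filter_subset _ _)) hAB)
    · have := hchain z (Finset.mem_filter.1 (hX hz)).1 x (Finset.mem_filter.1 (hX hx)).1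
        (hmin x hx) (hY hy)
      simpa using (Finset.mem_filter.1 this).2
  · obtain ⟨X, hX, hXt⟩ := Finset.exists_subset_card_eq
      (show t ≤ (A.filter fun x => ¬ t ≤ (f x).card).card by omega)
    obtain ⟨z, hz, hmax⟩ := Finset.exists_max_image X (fun x => (f x).card)
      (Finset.card_pos.1 (by omega))
    have hz' := Finset.mem_filter.1 (hX hz)
    obtain ⟨Y, hY, hYt⟩ := Finset.exists_subset_card_eq (s := B \ f z) (n := t) (by
      have := Finset.card_sdiff_add_card_eq_card (show f z ⊆ B from Finset.filter_subset _ _)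
      omega)
    refine hG False X Y ?_ hXt hYt fun x hx y hy => ?_
    · exact Finset.disjoint_of_subset_left (hX.trans (Finset.filter_subset _ _))
        (Finset.disjoint_of_subset_right (hY.trans Finset.sdiff_subset) hAB)
    · have hy' := Finset.mem_sdiff.1 (hY hy)
      simp only [iff_false]
      exact fun h => hy'.2 (hchain x (Finset.mem_filter.1 (hX hx)).1 z hz'.1 (hmax x hx)
        (Finset.mem_filter.2 ⟨hy'.1, h⟩))

open scoped Classical in
/-- In a typical graph, the color of some node in round `3` does not determine its color in
round `4`. -/
theorem NoHomogeneousPair.exists_refineColor [Fintype V] {q : ℕ} (hG : NoHomogeneousPair G t) (ht : 0 < t)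
    (hq : 1440 * t < 7 * q) (hV : Fintype.card V = q * q)
    (hdev : 8 * (Finset.univ.filter fun x =>
      64 * Fintype.card V ≤ degreeDev G x ^ 2).card < Fintype.card V)
    (hinj : Function.Injective (refineColor G 1)) :
    ∃ (v : V) (H : SimpleGraph V), refineColor G 3 v = refineColor H 3 v ∧
      refineColor G 4 v ≠ refineColor H 4 v := by
  have hq200 : 200 * q ≤ q * q := Nat.mul_le_mul_right _ (by omega)
  set N := q * q with hN
  rw [hV] at hdev
  set W : Finset V := Finset.univ.filter fun x => ¬ 64 * N ≤ degreeDev G x ^ 2 with hWdef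
  have hsplit := Finset.card_filter_add_card_filter_not (s := (Finset.univ : Finset V))
    fun x => 64 * N ≤ degreeDev G x ^ 2
  rw [Finset.card_univ, hV, ← hWdef] at hsplit
  have hW : 7 * N < 8 * W.card := by omega
  have hdeg : ∀ x ∈ W, N / 2 - 4 * q ≤ (nbrs G x).card ∧ (nbrs G x).card ≤ N / 2 + 4 * q := by
    intro x hx
    have h1 := (Finset.mem_filter.1 hx).2
    have h2 : degreeDev G x < 8 * q := by
      by_contra h
      refine h1 ?_
      calc 64 * N = (8 * q) ^ 2 := by rw [hN]; ring
        _ ≤ _ := Nat.pow_le_pow_left (not_lt.1 h) 2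
    rw [degreeDev, hV] at h2
    omega
  -- Pigeonhole over at most `9 * q` degrees. Of the `20 * t` nodes, a quarter survives the choice
  -- of `v`, and fewer than `t` of those are lost for lacking a common neighbor with `v`, leaving `4
  -- * t`.
  obtain ⟨δ, -, hδ⟩ := Finset.exists_lt_card_fiber_of_mul_lt_card_of_maps_to
    (s := W) (t := Finset.Icc (N / 2 - 4 * q) (N / 2 + 4 * q)) (f := fun x => (nbrs G x).card)
    (n := 20 * t) (fun x hx => Finset.mem_Icc.2 (hdeg x hx)) (by
      have h1 : (Finset.Icc (N / 2 - 4 * q) (N / 2 + 4 * q)).card ≤ 9 * q := by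
        rw [Nat.card_Icc]; omega
      have h2 := Nat.mul_le_mul_right (20 * t) h1
      have h3 : 8 * (9 * q * (20 * t)) ≤ 7 * N := by rw [hN]; nlinarith
      omega)
  set D := W.filter fun x => (nbrs G x).card = δ with hD
  have hfar : ∀ x ∈ D, N ≤ 4 * (W.filter fun v => x ≠ v ∧ ¬ G.Adj v x).card := by
    intro x hx
    have hxW := (Finset.mem_filter.1 hx).1
    have h1 : W \ insert x (nbrs G x) ⊆ W.filter fun v => x ≠ v ∧ ¬ G.Adj v x := by
      intro v hv
      simp only [Finset.mem_sdiff, Finset.mem_insert, mem_nbrs, not_or] at hv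
      exact Finset.mem_filter.2 ⟨hv.1, Ne.symm hv.2.1, fun h => hv.2.2 h.symm⟩
    have h2 := Finset.card_le_card h1
    have h3 := Finset.le_card_sdiff (insert x (nbrs G x)) W
    have h4 := Finset.card_insert_le x (nbrs G x)
    have h5 := (hdeg x hxW).2
    omega
  -- Double counting of non-adjacent pairs between `W` and `D`.
  obtain ⟨v, hvW, hv⟩ : ∃ v ∈ W, D.card ≤ 4 * (D.filter fun x => x ≠ v ∧ ¬ G.Adj v x).card := by
    by_contra! hlt
    have hWne : W.Nonempty := Finset.card_pos.1 (by omega)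
    have h1 := Finset.sum_lt_sum_of_nonempty hWne hlt
    have h2 := Finset.sum_le_sum hfar
    have h3 : ∑ v ∈ W, (D.filter fun x => x ≠ v ∧ ¬ G.Adj v x).card =
        ∑ x ∈ D, (W.filter fun v => x ≠ v ∧ ¬ G.Adj v x).card :=
      (Finset.sum_card_bipartiteAbove_eq_sum_card_bipartiteBelow
        (s := W) (t := D) fun v x => x ≠ v ∧ ¬ G.Adj v x)
    rw [← Finset.mul_sum, h3, Finset.mul_sum, Finset.sum_const, smul_eq_mul] at h1
    rw [Finset.sum_const, smul_eq_mul] at h2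
    have h4 : W.card * D.card ≤ N * D.card := Nat.mul_le_mul_right _ (by omega)
    nlinarith
  set S₀ := D.filter fun x => x ≠ v ∧ ¬ G.Adj v x with hS₀
  set Z := S₀.filter fun x => ∀ u, G.Adj v u → ¬ G.Adj u x with hZ
  have hZt : Z.card < t := by
    by_contra! hZt
    obtain ⟨X, hX, hXt⟩ := Finset.exists_subset_card_eq hZt
    obtain ⟨Y, hY, hYt⟩ := Finset.exists_subset_card_eq (s := nbrs G v) (n := t) (by
      have := (hdeg v hvW).1
      omega)
    refine hG False X Y ?_ hXt hYt fun x hx y hy => ?_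
    · refine Finset.disjoint_left.2 fun x hx hy => ?_
      exact (Finset.mem_filter.1 (Finset.mem_filter.1 (hX hx)).1).2.2 (mem_nbrs.1 (hY hy))
    · simp only [iff_false]
      exact fun h => (Finset.mem_filter.1 (hX hx)).2 y (mem_nbrs.1 (hY hy)) h.symm
  have hS : 4 * t ≤ (S₀ \ Z).card := by
    have := Finset.card_sdiff_add_card_eq_card (show Z ⊆ S₀ from Finset.filter_subset _ _)
    omega
  have hmem : ∀ x ∈ S₀ \ Z, (nbrs G x).card = δ ∧ (x ≠ v ∧ ¬ G.Adj v x) ∧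
      ∃ u, G.Adj v u ∧ G.Adj u x := by
    intro x hx
    obtain ⟨h1, h2⟩ := Finset.mem_sdiff.1 hx
    obtain ⟨h3, h4⟩ := Finset.mem_filter.1 h1
    refine ⟨(Finset.mem_filter.1 h3).2, h4, ?_⟩
    by_contra! hno
    exact h2 (Finset.mem_filter.2 ⟨h1, hno⟩)
  obtain ⟨a, ha, b, hb, c, hc, d, hd, hab, hcd, had, hcb, had', hcb'⟩ :=
    hG.exists_alternating ht hS
  obtain ⟨u, hvu, hua⟩ := (hmem a ha).2.2
  refine ⟨v, exists_refineColor_three_eq_four_ne hinj hab hcd had hcb had' hcb'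
    ((hmem a ha).1.trans (hmem c hc).1.symm) ((hmem b hb).1.trans (hmem d hd).1.symm) ?_ hvu hua⟩
  rintro x (rfl | rfl | rfl | rfl)
  exacts [(hmem x ha).2.1, (hmem x hb).2.1, (hmem x hc).2.1, (hmem x hd).2.1]

end typical

/-! ### Typical graphs exist with positive probability. -/

section random

open scoped Classical

variable {V : Type} [Fintype V]

/-- Union bound over two `t`-sets and a truth value, taken as a `Bool` to keep the index set finite.
-/
theorem mul_card_not_noHomogeneousPair_le (t : ℕ) :
    2 ^ (t * t) * (Finset.univ.filter fun G : SimpleGraph V => ¬ NoHomogeneousPair G t).card ≤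
      2 * Fintype.card V ^ t * Fintype.card V ^ t * Fintype.card (SimpleGraph V) := by
  let I : Finset (Finset V × Finset V × Bool) :=
    (Finset.univ.powersetCard t ×ˢ Finset.univ.powersetCard t ×ˢ Finset.univ).filter
      fun i => Disjoint i.1 i.2.1
  have hI : I.card ≤ 2 * Fintype.card V ^ t * Fintype.card V ^ t := by
    refine (Finset.card_filter_le _ _).trans ?_
    rw [Finset.card_product, Finset.card_product, Finset.card_powersetCard, Finset.card_univ,
      Finset.card_univ, Fintype.card_bool]
    have := Nat.choose_le_pow (Fintype.card V) t
    calc _ ≤ Fintype.card V ^ t * (Fintype.card V ^ t * 2) :=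
          Nat.mul_le_mul this (Nat.mul_le_mul_right _ this)
      _ = _ := by ring
  have h := mul_card_exists_le I (2 ^ (t * t))
    (fun i G => ∀ x ∈ i.1, ∀ y ∈ i.2.1, (G.Adj x y ↔ i.2.2 = true)) fun i hi => by
      simp only [I, Finset.mem_filter, Finset.mem_product, Finset.mem_powersetCard] at hi
      have := mul_card_adj_iff_le (i.2.2 = true) i.2.1 i.1 hi.2
      rw [hi.1.1.2, hi.1.2.1.2] at this
      convert this
  refine le_trans (Nat.mul_le_mul_left _ (Finset.card_le_card ?_))
    (h.trans (Nat.mul_le_mul_right _ hI))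
  intro G hG
  simp only [Finset.mem_filter, Finset.mem_univ, true_and] at hG ⊢
  by_contra hno
  refine hG fun p X Y hXY hX hY hp => hno ⟨(X, Y, decide p), ?_, fun x hx y hy => ?_⟩
  · simp only [I, Finset.mem_filter, Finset.mem_product, Finset.mem_powersetCard]
    exact ⟨⟨⟨Finset.subset_univ _, hX⟩, ⟨Finset.subset_univ _, hY⟩, Finset.mem_univ _⟩, hXY⟩
  · rw [hp x hx y hy, decide_eq_true_iff]

theorem mul_card_exists_degree_eq_le {m c : ℕ} (hV : Fintype.card V = 2 * m + 2)
    (hc : c ^ 2 ≤ 2 * m + 1) (T : Finset V) :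
    c * (Finset.univ.filter fun G : SimpleGraph V =>
      ∃ i ∈ T.offDiag, (nbrs G i.1).card = (nbrs G i.2).card).card ≤
      T.card * T.card * Fintype.card (SimpleGraph V) := by
  refine le_trans (mul_card_exists_le T.offDiag c
    (fun i G => (nbrs G i.1).card = (nbrs G i.2).card) fun i hi => ?_) (Nat.mul_le_mul_right _ ?_)
  · exact mul_card_degree_eq_le hV hc (Finset.mem_offDiag.1 hi).2.2
  · rw [Finset.offDiag_card]
    exact Nat.sub_le _ _

theorem mul_card_exists_refineColor_one_eq_le (R : ℕ) :
    2 ^ R * (Finset.univ.filter fun G : SimpleGraph V =>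
      ∃ i ∈ (Finset.univ : Finset V).offDiag, refineColor G 1 i.1 = refineColor G 1 i.2 ∧
        R ≤ ((({i.1, i.2} : Finset V)ᶜ).image (degreeOff G i.1 i.2)).card).card ≤
      Fintype.card V * Fintype.card V * Fintype.card (SimpleGraph V) := by
  refine le_trans (mul_card_exists_le (Finset.univ : Finset V).offDiag (2 ^ R)
    (fun i G => refineColor G 1 i.1 = refineColor G 1 i.2 ∧
        R ≤ ((({i.1, i.2} : Finset V)ᶜ).image (degreeOff G i.1 i.2)).card) fun i hi => ?_)
    (Nat.mul_le_mul_right _ ?_)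
  · exact mul_card_refineColor_one_eq_le R (Finset.mem_offDiag.1 hi).2.2
  · rw [Finset.offDiag_card, Finset.card_univ]
    exact Nat.sub_le _ _

theorem sixteen_mul_sq_lt_two_pow (k : ℕ) (hk : 24 ≤ k) :
    16 * ((15 * k + 2) * (15 * k + 2)) < 2 ^ k := by
  induction k, hk using Nat.le_induction with
  | base => norm_num
  | succ k hk ih =>
    rw [pow_succ]
    nlinarith

/-- With positive probability, a random graph is typical and has any given property of high
probability. -/
theorem exists_typical {k : ℕ} (hk : 24 ≤ k) (hV : Fintype.card V = 2 ^ k * 2 ^ k)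
    (E : SimpleGraph V → Prop)
    (hE : 8 * (Finset.univ.filter fun G => ¬ E G).card ≤ Fintype.card (SimpleGraph V)) :
    ∃ G : SimpleGraph V, E G ∧ NoHomogeneousPair G (4 * k + 1) ∧
      8 * (Finset.univ.filter fun x =>
        64 * Fintype.card V ≤ degreeDev G x ^ 2).card < Fintype.card V ∧
      Function.Injective (refineColor G 1) := by
  have hpow := sixteen_mul_sq_lt_two_pow k hk
  have hVpos : 0 < Fintype.card V := by rw [hV]; positivity
  have : Nonempty V := Fintype.card_pos_iff.1 hVpos
  have hM : 0 < Fintype.card (SimpleGraph V) := Fintype.card_pos_iff.2 ⟨⊥⟩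
  -- The size is `3 * (5 * k) + 2`, as `le_card_image_degreeOff` needs to leave `5 * k` levels.
  obtain ⟨T, -, hT⟩ := Finset.exists_subset_card_eq (s := (Finset.univ : Finset V))
    (n := 15 * k + 2) (by rw [Finset.card_univ, hV]; nlinarith)
  have b1 := mul_card_degreeDev_le (V := V)
  have b2 := mul_card_exists_degree_eq_le (V := V) (m := 2 ^ (k - 1) * 2 ^ k - 1) (c := 2 ^ k - 1)
    (by
      obtain ⟨j, rfl⟩ : ∃ j, k = j + 1 := ⟨k - 1, by omega⟩
      have : 0 < 2 ^ j * 2 ^ (j + 1) := by positivity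
      rw [hV, Nat.add_sub_cancel]
      have : 2 ^ (j + 1) * 2 ^ (j + 1) = 2 * (2 ^ j * 2 ^ (j + 1)) := by ring
      omega)
    (by
      obtain ⟨j, rfl⟩ : ∃ j, k = j + 1 := ⟨k - 1, by omega⟩
      rw [Nat.add_sub_cancel]
      have h0 : 0 < 2 ^ j := by positivity
      obtain ⟨x, hx⟩ : ∃ x, 2 ^ j = x + 1 := ⟨2 ^ j - 1, by omega⟩
      have h1 : 2 ^ (j + 1) - 1 = 2 * x + 1 := by rw [pow_succ, hx]; omega
      have h2 : 2 ^ j * 2 ^ (j + 1) - 1 = 2 * x * x + 4 * x + 1 := by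
        have : 2 ^ j * 2 ^ (j + 1) = 2 * x * x + 4 * x + 1 + 1 := by rw [pow_succ, hx]; ring
        omega
      rw [h1, h2]
      nlinarith) T
  -- With `5 * k` levels, the factor `2 ^ (5 * k)` beats the at most `2 ^ (4 * k)` pairs.
  have b3 := mul_card_exists_refineColor_one_eq_le (V := V) (5 * k)
  -- For `t = 4 * k + 1`, `t * t` exceeds the exponent `4 * k * t` of the number of pairs of sets by
  -- `t`.
  have b4 := mul_card_not_noHomogeneousPair_le (V := V) (4 * k + 1)
  set M := Fintype.card (SimpleGraph V)
  set B1 := Finset.univ.filter fun G : SimpleGraph V => Fintype.card V ≤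
      8 * (Finset.univ.filter fun x => 64 * Fintype.card V ≤ degreeDev G x ^ 2).card with hB1
  set B2 := Finset.univ.filter fun G : SimpleGraph V =>
      ∃ i ∈ T.offDiag, (nbrs G i.1).card = (nbrs G i.2).card with hB2
  set B3 := Finset.univ.filter fun G : SimpleGraph V =>
      ∃ i ∈ (Finset.univ : Finset V).offDiag, refineColor G 1 i.1 = refineColor G 1 i.2 ∧
        5 * k ≤ ((({i.1, i.2} : Finset V)ᶜ).image (degreeOff G i.1 i.2)).card with hB3
  set B4 := Finset.univ.filter fun G : SimpleGraph V => ¬ NoHomogeneousPair G (4 * k + 1) with hB4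
  set B5 := Finset.univ.filter fun G : SimpleGraph V => ¬ E G with hB5
  have hq16 : 32 ≤ 2 ^ k := by nlinarith
  have c2 : 16 * B2.card ≤ M := by
    rw [hT] at b2
    have h1 : 16 * ((15 * k + 2) * (15 * k + 2)) ≤ 2 ^ k - 1 := by omega
    have h0 : 0 < (15 * k + 2) * (15 * k + 2) := by positivity
    refine Nat.le_of_mul_le_mul_left (c := (15 * k + 2) * (15 * k + 2)) ?_ h0
    calc _ = 16 * ((15 * k + 2) * (15 * k + 2)) * B2.card := by ring
      _ ≤ (2 ^ k - 1) * B2.card := Nat.mul_le_mul_right _ h1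
      _ ≤ _ := b2
  have c3 : 16 * B3.card ≤ M := by
    refine Nat.le_of_mul_le_mul_left (c := 2 ^ (4 * k)) ?_ (by positivity)
    calc _ = 2 ^ (4 * k) * 16 * B3.card := by ring
      _ ≤ 2 ^ (4 * k) * 2 ^ k * B3.card :=
          Nat.mul_le_mul_right _ (Nat.mul_le_mul_left _ (by omega))
      _ = 2 ^ (5 * k) * B3.card := by ring
      _ ≤ _ := b3
      _ = _ := by rw [hV]; ring
  have c4 : 16 * B4.card ≤ M := by
    refine Nat.le_of_mul_le_mul_left (c := 2 * 2 ^ (4 * k * (4 * k + 1))) ?_ (by positivity)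
    calc _ = 2 ^ (4 * k * (4 * k + 1)) * 32 * B4.card := by ring
      _ ≤ 2 ^ (4 * k * (4 * k + 1)) * 2 ^ (4 * k + 1) * B4.card :=
          Nat.mul_le_mul_right _ (Nat.mul_le_mul_left _
            (hq16.trans (Nat.pow_le_pow_right two_pos (by omega))))
      _ = 2 ^ ((4 * k + 1) * (4 * k + 1)) * B4.card := by
          rw [← pow_add]
          congr 2
          ring
      _ ≤ _ := b4
      _ = _ := by
          rw [hV, ← pow_add, ← pow_mul]
          rw [mul_assoc 2, ← pow_add]
          congr 3
          ring
  -- The shares add up to at most `1/8 + 3/16 + 1/8 < 1`.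
  have hcard : B1.card + B2.card + B3.card + B4.card + B5.card < M := by omega
  have hlt : (B1 ∪ B2 ∪ B3 ∪ B4 ∪ B5).card < M := by
    have h1 := Finset.card_union_le (B1 ∪ B2 ∪ B3 ∪ B4) B5
    have h2 := Finset.card_union_le (B1 ∪ B2 ∪ B3) B4
    have h3 := Finset.card_union_le (B1 ∪ B2) B3
    have h4 := Finset.card_union_le B1 B2
    omega
  obtain ⟨G, -, hG⟩ := Finset.exists_mem_notMem_of_card_lt_card (t := Finset.univ) hlt
  simp only [Finset.mem_union, not_or] at hG
  obtain ⟨⟨⟨⟨g1, g2⟩, g3⟩, g4⟩, g5⟩ := hG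
  simp only [hB1, hB2, hB3, hB4, hB5, Finset.mem_filter, Finset.mem_univ, true_and, not_not,
    not_le] at g1 g2 g3 g4 g5
  refine ⟨G, g5, g4, g1, fun x y hxy => ?_⟩
  by_contra hne
  refine g3 ⟨(x, y), by simpa using hne, hxy, ?_⟩
  refine le_card_image_degreeOff (T := T) (by omega) (fun z hz w hw hzw => ?_) hne
  by_contra hne'
  exact g2 ⟨(z, w), Finset.mem_offDiag.2 ⟨hz, hw, hne'⟩, hzw⟩

/-- The random graph `G(n, 1/2)` is uniformly distributed. -/
theorem binomialRandom_half_real_mul_card (S : Set (SimpleGraph V)) :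
    (SimpleGraph.binomialRandom V edgeProbHalf).real S * Fintype.card (SimpleGraph V) =
      (Finset.univ.filter fun G => G ∈ S).card := by
  set μ := SimpleGraph.binomialRandom V edgeProbHalf with hμ
  have hsing : ∀ G : SimpleGraph V, μ.real {G} = (1 / 2) ^ ((Nat.card V).choose 2) := by
    intro G
    have hle : G.edgeSet.ncard ≤ (Nat.card V).choose 2 := by
      have := G.card_edgeFinset_le_card_choose_two
      rwa [Nat.card_eq_fintype_card, ← SimpleGraph.coe_edgeFinset, Set.ncard_coe_finset]
    rw [MeasureTheory.measureReal_def, hμ, SimpleGraph.binomialRandom_singleton]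
    have h1 : ((unitInterval.toNNReal edgeProbHalf : NNReal) : ℝ) = 1 / 2 := rfl
    have h2 : ((unitInterval.toNNReal (unitInterval.symm edgeProbHalf) : NNReal) : ℝ) = 1 / 2 := by
      show (1 - 1 / 2 : ℝ) = 1 / 2
      norm_num
    rw [ENNReal.toReal_mul, ENNReal.toReal_pow, ENNReal.toReal_pow, ENNReal.coe_toReal,
      ENNReal.coe_toReal, h1, h2, ← pow_add, Nat.add_sub_cancel' hle]
  have : MeasurableSingletonClass (SimpleGraph V) := ⟨fun G => by
    have h := SimpleGraph.measurable_edgeSet (measurableSet_singleton G.edgeSet)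
    convert h
    ext H
    simp⟩
  have hsum : ∀ s : Finset (SimpleGraph V),
      μ.real s = s.card * (1 / 2) ^ ((Nat.card V).choose 2) := by
    intro s
    rw [← MeasureTheory.sum_measureReal_singleton]
    simp [hsing]
  -- Total mass 1 identifies the common point mass as the inverse of the number of graphs.
  have huniv := hsum Finset.univ
  rw [Finset.coe_univ, MeasureTheory.probReal_univ, Finset.card_univ] at huniv
  have hS : S = ((Finset.univ.filter fun G => G ∈ S : Finset (SimpleGraph V)) : Set _) := by
    ext G; simp
  rw [hS, hsum]
  simp only [← hS]
  rw [mul_assoc, mul_comm _ (Fintype.card (SimpleGraph V) : ℝ), ← huniv, mul_one]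

/-- Among the graphs of an event of probability at least `7 / 8`, there is one in which the color
of some node in round `3` does not determine its color in round `4`. -/
theorem exists_mem_refineColor_three_eq_four_ne {k : ℕ} (hk : 24 ≤ k)
    (hV : Fintype.card V = 2 ^ k * 2 ^ k) (S : Set (SimpleGraph V))
    (hS : 7 / 8 ≤ (SimpleGraph.binomialRandom V edgeProbHalf).real S) :
    ∃ G ∈ S, ∃ (v : V) (H : SimpleGraph V), refineColor G 3 v = refineColor H 3 v ∧
      refineColor G 4 v ≠ refineColor H 4 v := by
  have hE : 8 * (Finset.univ.filter fun G => ¬ G ∈ S).card ≤ Fintype.card (SimpleGraph V) := by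
    have h1 := binomialRandom_half_real_mul_card S
    have h3 := Finset.card_filter_add_card_filter_not
      (s := (Finset.univ : Finset (SimpleGraph V))) fun G => G ∈ S
    rw [Finset.card_univ] at h3
    have h4 := mul_le_mul_of_nonneg_right hS (Nat.cast_nonneg (Fintype.card (SimpleGraph V)))
    rw [h1] at h4
    have h5 : 7 * Fintype.card (SimpleGraph V) ≤ 8 * (Finset.univ.filter fun G => G ∈ S).card := by
      have : (7 * Fintype.card (SimpleGraph V) : ℝ) ≤
        8 * (Finset.univ.filter fun G => G ∈ S).card := by linarith
      exact_mod_cast this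
    omega
  obtain ⟨G, hG, hpair, hdev, hinj⟩ := exists_typical hk hV (· ∈ S) hE
  have hpow := sixteen_mul_sq_lt_two_pow k hk
  exact ⟨G, hG, hpair.exists_refineColor (q := 2 ^ k) (by omega) (by nlinarith) hV hdev hinj⟩

end random

/-! ### The separation. -/

theorem refineProblem_four_notMem_MBnsnd_three : refineProblem 4 ∉ MBnsnd 3 := by
  rintro ⟨A, hA, hs⟩
  have h78 : (ENNReal.ofReal (7 / 8)) < 1 := by
    rw [← ENNReal.ofReal_one]
    exact (ENNReal.ofReal_lt_ofReal_iff one_pos).2 (by norm_num)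
  obtain ⟨n₀, hn₀⟩ := eventually_atTop.1 (hs.1.eventually (lt_mem_nhds h78))
  -- Arbitrarily large orders `4 ^ k` suffice, since the success probability is eventually above `7
  -- / 8`.
  obtain ⟨k, hk24, hkn⟩ : ∃ k, 24 ≤ k ∧ n₀ ≤ 2 ^ k * 2 ^ k :=
    ⟨max 24 n₀, le_max_left _ _, (le_max_right 24 n₀).trans
      (Nat.lt_two_pow_self.le.trans (Nat.le_mul_self _))⟩
  generalize hn : 2 ^ k * 2 ^ k = n at hkn
  obtain ⟨G, hG, v, H, h3, h4⟩ := exists_mem_refineColor_three_eq_four_ne hk24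
    (by rw [hn, Fintype.card_fin]) _
    ((ENNReal.ofReal_le_iff_le_toReal (MeasureTheory.measure_ne_top _ _)).1 (hn₀ n hkn).le)
  exact not_solvesOn_of_refineColor_eq hA hs h3 h4 hG

theorem mainTheorem11 : MBnsnd 3 ⊂ MBnsnd 4 :=
  (Set.ssubset_iff_of_subset (MBnsnd_mono (by norm_num))).2
    ⟨refineProblem 4, refineProblem_mem_MBnsnd 4, refineProblem_four_notMem_MBnsnd_three⟩
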